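/- Let $A$ be a finite alphabet. Consider partial functions $f : A^* \to A^*$, composed as partial functions. Such an $f$ is *polynomially balanced* if there is a polynomial $p$ with $|f(x)| \le p(|x|)$ and $|x| \le p(|f(x)|)$ for all $x \in \mathrm{Dom}(f)$. It is *polynomial-time computable* if there is a deterministic Turing machine that, on every input $x\in A^*$, halts within a number of steps polynomial in $|x|$, outputs $f(x)$ if $x \in \mathrm{Dom}(f)$, and rejects if $x \notin \mathrm{Dom}(f)$. Let $\mathsf{fP}$ be the set of all partial functions $A^* \to A^*$ that are polynomially balanced and polynomial-time computable; it is a monoid under composition. Let $\mathsf{invfP}$ be the set of those $f \in \mathsf{fP}$ that are injective on $\mathrm{Dom}(f)$ and regular in $\mathsf{fP}$, i.e. $f f' f = f$ for some $f' \in \mathsf{fP}$. Two elements $a, b$ of a monoid are *mutual inverses* if $aba = a$ and $bab = b$; a monoid is an *inverse monoid* if each of its elements has exactly one mutual inverse in it; an *inverse submonoid* of a monoid is a submonoid that is itself an inverse monoid. **Proposition.** $\mathsf{invfP}$ is a maximal inverse submonoid of $\mathsf{fP}$. That is, $\mathsf{invfP}$ is an inverse submonoid of $\mathsf{fP}$,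 and if $M$ is an inverse submonoid of $\mathsf{fP}$ with $\mathsf{invfP} \subseteq M \subseteq \mathsf{fP}$, then $M = \mathsf{invfP}$. -/

import Mathlib

open Turing

/-- Partial functions `α → α` form a monoid under composition, `f * g = f ∘ g`. -/
instance PFun.compositionMonoid (α : Type) : Monoid (α →. α) where
  mul f g := f.comp g
  one := PFun.id α
  mul_assoc f g h := PFun.comp_assoc f g h
  one_mul f := PFun.id_comp f
  mul_one f := PFun.comp_id f

/-- `b` is an inverse of `a` and `a` is an inverse of `b`. -/
def IsMutualInverse {S : Type} [Mul S] (a b : S) : Prop :=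
  a * b * a = a ∧ b * a * b = b

/-- `S` is an inverse monoid: every element has exactly one mutual inverse in `S`. -/
def IsInverseMonoid (S : Type) [Monoid S] : Prop :=
  ∀ a : S, ∃! b : S, IsMutualInverse a b

/-- `M` is an inverse submonoid of `F`: it is a submonoid of `F` (both being given as submonoids
of an ambient monoid `S`), and it is an inverse monoid by itself. -/
def IsInverseSubmonoid {S : Type} [Monoid S] (F M : Submonoid S) : Prop :=
  M ≤ F ∧ IsInverseMonoid M

/-- `f : A* → A*` is polynomially balanced: input and output lengths are polynomially related
on the domain of `f`. -/
def PolynomiallyBalanced {A : Type} (f : List A →. List A) : Prop :=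
  ∃ p : Polynomial ℕ, ∀ x y : List A, y ∈ f x →
    y.length ≤ p.eval x.length ∧ x.length ≤ p.eval y.length

/-- How a machine writes down the outcome of a run: `some y` (the machine accepts, with output `y`)
is written as the string `y`; `none` (the machine rejects) is written as one extra symbol,
which does not belong to the alphabet `A`. -/
def encodeOutcome {A : Type} : Option (List A) → List (Option A)
  | some y => y.map some
  | none => [none]

open Classical in
/-- The partial function `f` is computable by a deterministic polynomial-time Turing machine:
within polynomial time in the length of the input `x`, the machine either accepts and
outputs `f x`, or, when `f x` is undefined, rejects. -/
def PolyTimeComputable {A : Type} (f : List A →. List A) : Prop :=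
  Nonempty (TM2ComputableInPolyTime (id : List A → List A) encodeOutcome
    (fun x => (f x).toOption))

/-- The polynomially balanced partial functions on `A*` that are computable by
a deterministic polynomial-time Turing machine. -/
def fP (A : Type) : Set (List A →. List A) :=
  {f | PolynomiallyBalanced f ∧ PolyTimeComputable f}

/-- A partial function is injective: it is injective on its domain. -/
def PartialInjective {A : Type} (f : List A →. List A) : Prop :=
  ∀ x₁ x₂ y : List A, y ∈ f x₁ → y ∈ f x₂ → x₁ = x₂

/-- The injective regular elements of `fP`; `f` is regular in `fP` if it has
an inverse in `fP`. -/
def invfP (A : Type) : Set (List A →. List A) :=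
  {f | f ∈ fP A ∧ PartialInjective f ∧ ∃ f' ∈ fP A, f * f' * f = f}

/-! An element `f` of `fP A` lies in `invfP A` exactly when its inverse relation is again a function
in `fP A` (`mem_invfP_iff`): if `f * f' * f = f` and `f` is injective, then the fixed points of `f *
f'` form the image of `f`, and `f'` restricted to them inverts `f`. Closure under products and
existence of mutual inverses follow at once. Uniqueness holds because two injective mutual inverses
are inverse relations of each other (`mem_iff_of_isMutualInverse`).

For maximality, let `b` be the mutual inverse of `a` in `M`. The identity on a single word is in
`invfP A`, hence in `M`, and idempotents of an inverse monoid commute. So `b * a` commutes with all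
these identities, which forces it to be a partial identity. Thus `a` is injective, and `b` witnesses
its regularity.

All of this needs `fP A` to contain the identity, products, and the identity restricted to the fixed
points of a computable map. One construction, `PolyTimeOnWords.splice`, yields all three: run a
machine, split its output into two words, run a second machine on one of them and merge the result
with the other. -/

open Function (update)

/-! ### Runs of bounded length -/

namespace Turing

open StateTransition

/-- `b` is reached from `a` in at most `n` steps of `f`. -/
def ReachesIn {C : Type} (f : C → Option C) (n : ℕ) (a b : C) : Prop :=
  Nonempty (EvalsToInTime f a (some b) n)

namespace ReachesIn

variable {C : Type} {f : C → Option C} {a b c : C} {m n : ℕ}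

theorem refl (f : C → Option C) (a : C) : ReachesIn f 0 a a :=
  ⟨EvalsToInTime.refl f a⟩

theorem trans (h₁ : ReachesIn f m a b) (h₂ : ReachesIn f n b c) : ReachesIn f (m + n) a c := by
  obtain ⟨h₁⟩ := h₁
  obtain ⟨h₂⟩ := h₂
  rw [add_comm]
  exact ⟨EvalsToInTime.trans f m n a b _ h₁ h₂⟩

theorem mono (h : ReachesIn f m a b) (hmn : m ≤ n) : ReachesIn f n a b := by
  obtain ⟨h⟩ := h
  exact ⟨⟨h.toEvalsTo, h.steps_le_m.trans hmn⟩⟩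

theorem single (h : f a = some b) : ReachesIn f 1 a b :=
  ⟨⟨⟨1, h⟩, le_rfl⟩⟩

theorem head (h : f a = some b) (h' : ReachesIn f n b c) : ReachesIn f (n + 1) a c :=
  ((single h).trans h').mono (by omega)

/-- Transport of a run along a map that commutes with the steps. -/
theorem map {D : Type} {g : D → Option D} (φ : C → D)
    (hφ : ∀ x y, f x = some y → g (φ x) = some (φ y)) (h : ReachesIn f n a b) :
    ReachesIn g n (φ a) (φ b) := by
  obtain ⟨⟨⟨k, hk⟩, hkn⟩⟩ := h
  refine mono ?_ hkn
  change ReachesIn g k _ _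
  clear hkn
  induction k generalizing a with
  | zero =>
    have : a = b := by simpa using hk
    exact this ▸ refl _ _
  | succ k ih =>
    rw [Function.iterate_succ_apply] at hk
    cases hx : f a with
    | none =>
      have hnone : ∀ j, (flip bind f)^[j] (none : Option C) = none := by
        intro j
        induction j with
        | zero => rfl
        | succ j ihj => rw [Function.iterate_succ_apply]; exact ihj
      have : (flip bind f) (some a) = none := hx
      rw [this, hnone] at hk
      cases hk
    | some x =>
      have : (flip bind f) (some a) = some x := hx
      rw [this] at hk
      exact head (hφ _ _ hx) (ih hk)

end ReachesIn

/-! ### Running a machine as a part of a larger one -/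

namespace TM2

open Stmt

section Lift

variable {K K' : Type} [DecidableEq K] [DecidableEq K'] {Γ' : K' → Type} {Λ Λ' σ σ' : Type}

/-- A statement of a machine, run as a part of a larger machine on some of its stacks and on a
component of its state; instead of halting, it jumps to the label `ret`. -/
def Stmt.lift (ι : K → K') (get : σ' → σ) (set : σ → σ' → σ') (lab : Λ → Λ') (ret : Λ') :
    Stmt (fun k => Γ' (ι k)) Λ σ → Stmt Γ' Λ' σ'
  | push k f q => push (ι k) (fun s => f (get s)) (Stmt.lift ι get set lab ret q)
  | peek k f q => peek (ι k) (fun s o => set (f (get s) o) s) (Stmt.lift ι get set lab ret q)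
  | pop k f q => pop (ι k) (fun s o => set (f (get s) o) s) (Stmt.lift ι get set lab ret q)
  | load f q => load (fun s => set (f (get s)) s) (Stmt.lift ι get set lab ret q)
  | branch f q₁ q₂ =>
    branch (fun s => f (get s)) (Stmt.lift ι get set lab ret q₁) (Stmt.lift ι get set lab ret q₂)
  | goto f => goto (fun s => lab (f (get s)))
  | halt => goto (fun _ => ret)

/-- The configuration of the larger machine that belongs to a configuration of its part. -/
def Cfg.lift (ι : K → K') (lab : Λ → Λ') (ret : Λ') (G : σ → σ')
    (F : (∀ k, List (Γ' (ι k))) → ∀ k', List (Γ' k')) (c : Cfg (fun k => Γ' (ι k)) Λ σ) :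
    Cfg Γ' Λ' σ' :=
  ⟨some (c.l.elim ret lab), G c.var, F c.stk⟩

variable {ι : K → K'} {get : σ' → σ} {set : σ → σ' → σ'} {lab : Λ → Λ'} {ret : Λ'} {G : σ → σ'}
  {F : (∀ k, List (Γ' (ι k))) → ∀ k', List (Γ' k')}

/-- `G` and `F` freeze the rest of the state and of the stacks, which the part never touches; `set`
therefore only has to behave well on the range of `G`. -/
theorem stepAux_lift (hget : ∀ v, get (G v) = v) (hset : ∀ v w, set w (G v) = G w)
    (hF : ∀ S k, F S (ι k) = S k)
    (hF' : ∀ S k x, update (F S) (ι k) x = F (update S k x))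
    (q : Stmt (fun k => Γ' (ι k)) Λ σ) (v : σ) (S : ∀ k, List (Γ' (ι k))) :
    stepAux (q.lift ι get set lab ret) (G v) (F S) = (stepAux q v S).lift ι lab ret G F := by
  induction q generalizing v S with
  | push k f q ih => simp only [Stmt.lift, stepAux, hget, hF, hF', ih]
  | peek k f q ih => simp only [Stmt.lift, stepAux, hget, hset, hF, ih]
  | pop k f q ih => simp only [Stmt.lift, stepAux, hget, hset, hF, hF', ih]
  | load f q ih => simp only [Stmt.lift, stepAux, hget, hset, ih]
  | branch f q₁ q₂ ih₁ ih₂ =>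
    simp only [Stmt.lift, stepAux, hget, ih₁, ih₂]
    cases f v <;> rfl
  | goto f => simp only [Stmt.lift, stepAux, hget]; rfl
  | halt => rfl

theorem reachesIn_lift {M : Λ → Stmt (fun k => Γ' (ι k)) Λ σ} {M' : Λ' → Stmt Γ' Λ' σ'}
    (hM : ∀ l, M' (lab l) = (M l).lift ι get set lab ret)
    (hget : ∀ v, get (G v) = v) (hset : ∀ v w, set w (G v) = G w)
    (hF : ∀ S k, F S (ι k) = S k)
    (hF' : ∀ S k x, update (F S) (ι k) x = F (update S k x))
    {n : ℕ} {a b : Cfg (fun k => Γ' (ι k)) Λ σ} (h : ReachesIn (step M) n a b) :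
    ReachesIn (step M') n (a.lift ι lab ret G F) (b.lift ι lab ret G F) := by
  refine h.map _ ?_
  rintro ⟨_ | l, v, S⟩ y hxy
  -- A halted configuration is lifted to one at `ret`, which may go on, but there is no step to
  -- match.
  · cases hxy
  · obtain rfl : stepAux (M l) v S = y := by simpa [step] using hxy
    rw [← stepAux_lift hget hset hF hF', ← hM]
    rfl

end Lift

section Push

variable {K : Type} [DecidableEq K] {Γ : K → Type} {Λ σ : Type}

open Classical in
/-- Push a letter if there is one. -/
noncomputable def Stmt.pushOption (k : K) (f : σ → Option (Γ k)) (q : Stmt Γ Λ σ) : Stmt Γ Λ σ :=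
  if h : Nonempty (Γ k) then
    branch (fun s => (f s).isSome) (push k (fun s => (f s).getD h.some) q) q
  else q

theorem stepAux_pushOption (k : K) (f : σ → Option (Γ k)) (q : Stmt Γ Λ σ) (v : σ)
    (S : ∀ k, List (Γ k)) :
    stepAux (q.pushOption k f) v S = stepAux q v (update S k ((f v).toList ++ S k)) := by
  unfold Stmt.pushOption
  split_ifs with h
  · cases hf : f v <;> simp [hf]
  -- Over an empty alphabet `push` has no default letter, but there is also never a letter to push.
  · cases hf : f v with
    | none => simp
    | some a => exact absurd ⟨a⟩ h

/-- Push a fixed word. -/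
def Stmt.pushList (k : K) (w : List (Γ k)) (q : Stmt Γ Λ σ) : Stmt Γ Λ σ :=
  w.foldl (fun q a => push k (fun _ => a) q) q

theorem stepAux_pushList (k : K) (w : List (Γ k)) (q : Stmt Γ Λ σ) (v : σ)
    (S : ∀ k, List (Γ k)) :
    stepAux (q.pushList k w) v S = stepAux q v (update S k (w ++ S k)) := by
  unfold Stmt.pushList
  induction w generalizing q S with
  | nil => simp
  | cons a w ih => simp [ih]

end Push

end TM2

theorem initList_eq (tm : FinTM2) (s : List (tm.Γ tm.k₀)) :
    initList tm s = ⟨some tm.main, tm.initialState, update (fun _ => []) tm.k₀ s⟩ := by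
  unfold initList
  congr 1
  funext k
  by_cases h : k = tm.k₀
  · subst h; simp
  · simp [h]

theorem haltList_eq (tm : FinTM2) (s : List (tm.Γ tm.k₁)) :
    haltList tm s = ⟨none, tm.initialState, update (fun _ => []) tm.k₁ s⟩ := by
  unfold haltList
  congr 1
  funext k
  by_cases h : k = tm.k₁
  · subst h; simp
  · simp [h]

open TM2

/-! ### Splicing two machines -/

namespace Splice

/-- The stacks of the spliced machine in addition to those of its two parts. -/
inductive Aux
  | left | right | rightRev | acc | out
  deriving DecidableEq

instance : Fintype Aux :=
  ⟨{.left, .right, .rightRev, .acc, .out}, fun x => by cases x <;> decide⟩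

/-- The labels of the spliced machine in addition to those of its two parts. -/
inductive Phase
  | split | loadLeft | loadRight | merge | finish

instance : Fintype Phase :=
  ⟨⟨{.split, .loadLeft, .loadRight, .merge, .finish}, by simp⟩, fun x => by cases x <;> simp⟩

variable (M₁ M₂ : FinTM2) (ρ γ : Type)

/-- The stacks of the spliced machine. -/
abbrev Stack : Type := M₁.K ⊕ M₂.K ⊕ Aux

/-- The alphabets of the spliced machine. -/
abbrev Alphabet : Stack M₁ M₂ → Type
  | .inl k => M₁.Γ k
  | .inr (.inl k) => M₂.Γ k
  | .inr (.inr .left) => M₂.Γ M₂.k₀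
  | .inr (.inr .right) => ρ
  | .inr (.inr .rightRev) => ρ
  | .inr (.inr .acc) => γ
  | .inr (.inr .out) => γ

/-- The labels of the spliced machine. -/
abbrev Label : Type := M₁.Λ ⊕ M₂.Λ ⊕ Phase

/-- The internal states of the spliced machine: those of its parts, a flag, and buffers for the
letters that are popped. -/
@[ext]
structure State where
  fst : M₁.σ
  snd : M₂.σ
  ok : Bool
  bufMid : Option (M₁.Γ M₁.k₁)
  bufLeft : Option (M₂.Γ M₂.k₀)
  bufRight : Option ρ
  bufOut : Option (M₂.Γ M₂.k₁)
  bufAcc : Option γ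

noncomputable instance [Finite (M₁.Γ M₁.k₁)] [Finite (M₂.Γ M₂.k₁)] [Finite ρ] [Finite γ] :
    Fintype (State M₁ M₂ ρ γ) :=
  have := M₁.σFin
  have := M₂.σFin
  have := M₂.Γk₀Fin
  have : Finite (State M₁ M₂ ρ γ) := Finite.of_injective
    (fun s => (s.fst, s.snd, s.ok, s.bufMid, s.bufLeft, s.bufRight, s.bufOut, s.bufAcc))
    (fun s t h => by
      simp only [Prod.mk.injEq] at h
      obtain ⟨h₁, h₂, h₃, h₄, h₅, h₆, h₇, h₈⟩ := h
      ext1 <;> assumption)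
  Fintype.ofFinite _

variable {M₁ M₂ ρ γ}

/-- The state with the given first three components and with empty buffers. -/
@[simps]
def clean (v₁ : M₁.σ) (v₂ : M₂.σ) (ok : Bool) : State M₁ M₂ ρ γ :=
  ⟨v₁, v₂, ok, none, none, none, none, none⟩

/-- Empty the buffers. -/
def State.reset (s : State M₁ M₂ ρ γ) : State M₁ M₂ ρ γ := clean s.fst s.snd s.ok

variable (toLeft : M₁.Γ M₁.k₁ → Option (M₂.Γ M₂.k₀)) (toRight : M₁.Γ M₁.k₁ → Option ρ)
  (comb : Option (M₂.Γ M₂.k₁) → Option ρ → Option γ) (bad : γ)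

/-- The statements of the spliced machine. -/
noncomputable def program : Label M₁ M₂ → Stmt (Alphabet M₁ M₂ ρ γ) (Label M₁ M₂) (State M₁ M₂ ρ γ)
  | .inl l => Stmt.lift (Γ' := Alphabet M₁ M₂ ρ γ) (ι := Sum.inl) (fun s => s.fst)
      (fun v s => { s with fst := v }) .inl (.inr (.inr .split)) (M₁.m l)
  | .inr (.inl l) => Stmt.lift (Γ' := Alphabet M₁ M₂ ρ γ) (ι := fun k => .inr (.inl k))
      (fun s => s.snd) (fun v s => { s with snd := v }) (fun l => .inr (.inl l))
      (.inr (.inr .merge)) (M₂.m l)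
  | .inr (.inr .split) =>
      .pop (.inl M₁.k₁) (fun s o => { s with bufMid := o }) <|
      .branch (fun s => s.bufMid.isSome)
        (.pushOption (.inr (.inr .left)) (fun s => s.bufMid.bind toLeft) <|
          .pushOption (.inr (.inr .right)) (fun s => s.bufMid.bind toRight) <|
          .load .reset <| .goto fun _ => .inr (.inr .split))
        (.goto fun _ => .inr (.inr .loadLeft))
  | .inr (.inr .loadLeft) =>
      .pop (.inr (.inr .left)) (fun s o => { s with bufLeft := o }) <|
      .branch (fun s => s.bufLeft.isSome)
        (.pushOption (.inr (.inl M₂.k₀)) (fun s => s.bufLeft) <|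
          .load .reset <| .goto fun _ => .inr (.inr .loadLeft))
        (.goto fun _ => .inr (.inr .loadRight))
  | .inr (.inr .loadRight) =>
      .pop (.inr (.inr .right)) (fun s o => { s with bufRight := o }) <|
      .branch (fun s => s.bufRight.isSome)
        (.pushOption (.inr (.inr .rightRev)) (fun s => s.bufRight) <|
          .load .reset <| .goto fun _ => .inr (.inr .loadRight))
        (.goto fun _ => .inr (.inl M₂.main))
  | .inr (.inr .merge) =>
      .pop (.inr (.inl M₂.k₁)) (fun s o => { s with bufOut := o }) <|
      .pop (.inr (.inr .rightRev)) (fun s o => { s with bufRight := o }) <|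
      .branch (fun s => s.bufOut.isSome || s.bufRight.isSome)
        (.pushOption (.inr (.inr .acc)) (fun s => comb s.bufOut s.bufRight) <|
          .load (fun s => clean s.fst s.snd (s.ok && (comb s.bufOut s.bufRight).isSome)) <|
          .goto fun _ => .inr (.inr .merge))
        (.goto fun _ => .inr (.inr .finish))
  | .inr (.inr .finish) =>
      .pop (.inr (.inr .acc)) (fun s o => { s with bufAcc := o }) <|
      .branch (fun s => s.bufAcc.isSome)
        (.pushOption (.inr (.inr .out)) (fun s => if s.ok then s.bufAcc else none) <|
          .load .reset <| .goto fun _ => .inr (.inr .finish))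
        (.pushOption (.inr (.inr .out)) (fun s => if s.ok then none else some bad) <|
          .load (fun s => clean s.fst s.snd true) .halt)

/-- The stacks of the spliced machine with given contents. -/
def contents (S₁ : ∀ k, List (M₁.Γ k)) (S₂ : ∀ k, List (M₂.Γ k)) (l : List (M₂.Γ M₂.k₀))
    (r r' : List ρ) (a o : List γ) : ∀ k, List (Alphabet M₁ M₂ ρ γ k)
  | .inl k => S₁ k
  | .inr (.inl k) => S₂ k
  | .inr (.inr .left) => l
  | .inr (.inr .right) => r
  | .inr (.inr .rightRev) => r'
  | .inr (.inr .acc) => a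
  | .inr (.inr .out) => o

section Update

variable (S₁ : ∀ k, List (M₁.Γ k)) (S₂ : ∀ k, List (M₂.Γ k)) (l : List (M₂.Γ M₂.k₀))
    (r r' : List ρ) (a o : List γ)

theorem update_fst (k : M₁.K) (x : List (M₁.Γ k)) :
    update (contents S₁ S₂ l r r' a o) (.inl k) x
      = contents (update S₁ k x) S₂ l r r' a o := by
  funext k'
  obtain j | j | j := k'
  · by_cases h : j = k
    · subst h; simp [contents]
    · simp [contents, h]
  · simp [contents]
  · cases j <;> simp [contents]

theorem update_snd (k : M₂.K) (x : List (M₂.Γ k)) :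
    update (contents S₁ S₂ l r r' a o) (.inr (.inl k)) x
      = contents S₁ (update S₂ k x) l r r' a o := by
  funext k'
  obtain j | j | j := k'
  · simp [contents]
  · by_cases h : j = k
    · subst h; simp [contents]
    · simp [contents, h]
  · cases j <;> simp [contents]

theorem update_left (x : List (M₂.Γ M₂.k₀)) :
    update (contents S₁ S₂ l r r' a o) (.inr (.inr .left)) x = contents S₁ S₂ x r r' a o := by
  funext k'
  obtain j | j | _ | _ | _ | _ | _ := k' <;> simp [contents]

theorem update_right (x : List ρ) :
    update (contents S₁ S₂ l r r' a o) (.inr (.inr .right)) x = contents S₁ S₂ l x r' a o := by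
  funext k'
  obtain j | j | _ | _ | _ | _ | _ := k' <;> simp [contents]

theorem update_rightRev (x : List ρ) :
    update (contents S₁ S₂ l r r' a o) (.inr (.inr .rightRev)) x = contents S₁ S₂ l r x a o := by
  funext k'
  obtain j | j | _ | _ | _ | _ | _ := k' <;> simp [contents]

theorem update_acc (x : List γ) :
    update (contents S₁ S₂ l r r' a o) (.inr (.inr .acc)) x = contents S₁ S₂ l r r' x o := by
  funext k'
  obtain j | j | _ | _ | _ | _ | _ := k' <;> simp [contents]

theorem update_out (x : List γ) :
    update (contents S₁ S₂ l r r' a o) (.inr (.inr .out)) x = contents S₁ S₂ l r r' a x := by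
  funext k'
  obtain j | j | _ | _ | _ | _ | _ := k' <;> simp [contents]

end Update

/-- A configuration of the spliced machine in one of its own phases. -/
def cfg (p : Phase) (ok : Bool) (S₁ : ∀ k, List (M₁.Γ k)) (S₂ : ∀ k, List (M₂.Γ k))
    (l : List (M₂.Γ M₂.k₀)) (r r' : List ρ) (a o : List γ) :
    Cfg (Alphabet M₁ M₂ ρ γ) (Label M₁ M₂) (State M₁ M₂ ρ γ) :=
  ⟨some (.inr (.inr p)), clean M₁.initialState M₂.initialState ok, contents S₁ S₂ l r r' a o⟩

/-- Moving a word from stack to stack reverses it. Both words get reversed here and once more while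
loading, so that they are later read in the original order. -/
theorem reachesIn_split (w : List (M₁.Γ M₁.k₁)) (l : List (M₂.Γ M₂.k₀)) (r : List ρ) :
    ReachesIn (step (program toLeft toRight comb bad)) (w.length + 1)
      (cfg .split true (update (fun _ => []) M₁.k₁ w) (fun _ => []) l r [] [] [])
      (cfg .loadLeft true (fun _ => []) (fun _ => []) ((w.filterMap toLeft).reverse ++ l)
        ((w.filterMap toRight).reverse ++ r) [] [] []) := by
  induction w generalizing l r with
  | nil =>
    refine .single ?_
    simp only [cfg, step, program, stepAux, contents, update_fst]
    simp
    rfl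
  | cons b w ih =>
    have h := ih ((toLeft b).toList ++ l) ((toRight b).toList ++ r)
    refine .head (b := cfg .split true (update (fun _ => []) M₁.k₁ w) (fun _ => [])
      ((toLeft b).toList ++ l) ((toRight b).toList ++ r) [] [] []) ?_ ?_
    · simp only [cfg, step, program, stepAux, stepAux_pushOption, contents, update_fst,
        update_left, update_right]
      simp [State.reset]
    · cases h₁ : toLeft b <;> cases h₂ : toRight b <;> simpa [h₁, h₂] using h

theorem reachesIn_loadLeft (l m : List (M₂.Γ M₂.k₀)) (r : List ρ) :
    ReachesIn (step (program (M₁ := M₁) toLeft toRight comb bad)) (l.length + 1)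
      (cfg .loadLeft true (fun _ => []) (update (fun _ => []) M₂.k₀ m) l r [] [] [])
      (cfg .loadRight true (fun _ => []) (update (fun _ => []) M₂.k₀ (l.reverse ++ m)) [] r
        [] [] []) := by
  induction l generalizing m with
  | nil =>
    refine .single ?_
    simp only [cfg, step, program, stepAux, contents, update_left]
    simp
    rfl
  | cons b l ih =>
    refine .head (b := cfg .loadLeft true (fun _ => []) (update (fun _ => []) M₂.k₀ (b :: m))
      l r [] [] []) ?_ (by simpa using ih (b :: m))
    simp only [cfg, step, program, stepAux, stepAux_pushOption, contents, update_left, update_snd]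
    simp [State.reset]

theorem reachesIn_loadRight (S : ∀ k, List (M₂.Γ k)) (r r' : List ρ) :
    ReachesIn (step (program (M₁ := M₁) toLeft toRight comb bad)) (r.length + 1)
      (cfg .loadRight true (fun _ => []) S [] r r' [] [])
      ⟨some (.inr (.inl M₂.main)), clean M₁.initialState M₂.initialState true,
        contents (fun _ => []) S [] [] (r.reverse ++ r') [] []⟩ := by
  induction r generalizing r' with
  | nil =>
    refine .single ?_
    simp only [cfg, step, program, stepAux, contents, update_right]
    simp
    rfl
  | cons b r ih =>
    refine .head (b := cfg .loadRight true (fun _ => []) S [] r (b :: r') [] []) ?_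
      (by simpa using ih (b :: r'))
    simp only [cfg, step, program, stepAux, stepAux_pushOption, contents, update_right,
      update_rightRev]
    simp [State.reset]

theorem step_merge (ok : Bool) (g : List (M₂.Γ M₂.k₁)) (r : List ρ) (t : List γ)
    (h : g ≠ [] ∨ r ≠ []) :
    step (program (M₁ := M₁) toLeft toRight comb bad)
      (cfg .merge ok (fun _ => []) (update (fun _ => []) M₂.k₁ g) [] [] r t [])
      = some (cfg .merge (ok && (comb g.head? r.head?).isSome) (fun _ => [])
          (update (fun _ => []) M₂.k₁ g.tail) [] [] r.tail ((comb g.head? r.head?).toList ++ t)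
          []) := by
  have h' : (g.head?.isSome || r.head?.isSome) = true := by
    cases g <;> cases r <;> simp_all
  simp only [cfg, step, program, stepAux, stepAux_pushOption, contents, update_rightRev,
    update_snd, update_acc]
  simp [h']

theorem zipWithAll_eq_cons {α β δ : Type} (f : Option α → Option β → δ) (g : List α) (r : List β)
    (h : g ≠ [] ∨ r ≠ []) :
    List.zipWithAll f g r = f g.head? r.head? :: List.zipWithAll f g.tail r.tail := by
  cases g <;> cases r <;> simp_all

theorem length_zipWithAll_le {α β δ : Type} (f : Option α → Option β → δ) (g : List α)
    (r : List β) : (List.zipWithAll f g r).length ≤ g.length + r.length := by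
  induction g generalizing r with
  | nil => simp
  | cons a g ih =>
    cases r with
    | nil => simp
    | cons b r =>
      have := ih r
      simp only [List.zipWithAll_cons_cons, List.length_cons]
      omega

theorem reachesIn_merge (ok : Bool) (g : List (M₂.Γ M₂.k₁)) (r : List ρ) (t : List γ) :
    ReachesIn (step (program (M₁ := M₁) toLeft toRight comb bad)) (g.length + r.length + 1)
      (cfg .merge ok (fun _ => []) (update (fun _ => []) M₂.k₁ g) [] [] r t [])
      (cfg .finish (ok && (List.zipWithAll comb g r).all Option.isSome) (fun _ => [])
        (fun _ => []) [] [] [] ((List.zipWithAll comb g r).reduceOption.reverse ++ t) []) := by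
  -- Either word may run out first, so the induction is on the total length.
  induction h : g.length + r.length using Nat.strong_induction_on generalizing ok g r t with
  | _ n ih =>
  by_cases hgr : g ≠ [] ∨ r ≠ []
  · have hlen : g.tail.length + r.tail.length < n := by
      subst h
      cases g <;> cases r <;> simp_all; omega
    have h' := (ReachesIn.head (step_merge (M₁ := M₁) toLeft toRight comb bad ok g r t hgr)
      (ih _ hlen _ _ _ _ rfl)).mono (n := n + 1) (by omega)
    rw [zipWithAll_eq_cons comb g r hgr]
    revert h'
    cases comb g.head? r.head? <;> simp [List.reduceOption_cons_of_some,
      List.reduceOption_cons_of_none]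
  · obtain ⟨rfl, rfl⟩ : g = [] ∧ r = [] := by simpa using hgr
    refine .mono (.single ?_) (Nat.le_add_left 1 n)
    simp only [cfg, step, program, stepAux, contents, update_snd, update_rightRev]
    simp
    rfl

/-- Even after a failure `acc` is emptied and the flag is set back to `true`, since a run must end
in the initial state with all stacks but the output empty. -/
theorem reachesIn_finish (ok : Bool) (t o : List γ) :
    ReachesIn (step (program (M₁ := M₁) (M₂ := M₂) toLeft toRight comb bad)) (t.length + 1)
      (cfg .finish ok (fun _ => []) (fun _ => []) [] [] [] t o)
      ⟨none, clean M₁.initialState M₂.initialState true, contents (fun _ => []) (fun _ => [])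
        [] [] [] [] (if ok then t.reverse ++ o else bad :: o)⟩ := by
  induction t generalizing o with
  | nil =>
    refine .single ?_
    simp only [cfg, step, program, stepAux, stepAux_pushOption, contents, update_acc, update_out]
    cases ok <;> simp
  | cons b t ih =>
    refine .head (b := cfg .finish ok (fun _ => []) (fun _ => []) [] [] [] t
      (if ok then b :: o else o)) ?_ ?_
    · simp only [cfg, step, program, stepAux, stepAux_pushOption, contents, update_acc,
        update_out]
      cases ok <;> simp [State.reset]
    · cases ok
      · exact ih o
      · simpa using ih (b :: o)

/-- Run `M₁`, split the output into two words by `toLeft` and `toRight`, run `M₂` on the first one,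
and merge the result letter by letter with the second one by `comb`; the output is the word `bad`
if `comb` has been undefined. -/
noncomputable def machine (M₁ M₂ : FinTM2) {ρ γ : Type} [Finite (M₁.Γ M₁.k₁)]
    [Finite (M₂.Γ M₂.k₁)] [Finite ρ] [Finite γ]
    (toLeft : M₁.Γ M₁.k₁ → Option (M₂.Γ M₂.k₀)) (toRight : M₁.Γ M₁.k₁ → Option ρ)
    (comb : Option (M₂.Γ M₂.k₁) → Option ρ → Option γ) (bad : γ) : FinTM2 :=
  have := M₁.kFin
  have := M₂.kFin
  have := M₁.ΛFin
  have := M₂.ΛFin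
  { K := Stack M₁ M₂
    k₀ := .inl M₁.k₀
    k₁ := .inr (.inr .out)
    Γ := Alphabet M₁ M₂ ρ γ
    Λ := Label M₁ M₂
    main := .inl M₁.main
    σ := State M₁ M₂ ρ γ
    initialState := clean M₁.initialState M₂.initialState true
    Γk₀Fin := M₁.Γk₀Fin
    m := program toLeft toRight comb bad }

theorem contents_nil : contents (M₁ := M₁) (M₂ := M₂) (ρ := ρ) (γ := γ) (fun _ => [])
    (fun _ => []) [] [] [] [] [] = fun _ => [] := by
  funext k
  obtain j | j | _ | _ | _ | _ | _ := k <;> rfl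

theorem reachesIn_fst {n : ℕ} {w : List (M₁.Γ M₁.k₀)} {u : List (M₁.Γ M₁.k₁)}
    (h : ReachesIn M₁.step n (initList M₁ w) (haltList M₁ u)) :
    ReachesIn (step (program (M₂ := M₂) toLeft toRight comb bad)) n
      ⟨some (.inl M₁.main), clean M₁.initialState M₂.initialState true,
        contents (update (fun _ => []) M₁.k₀ w) (fun _ => []) [] [] [] [] []⟩
      (cfg .split true (update (fun _ => []) M₁.k₁ u) (fun _ => []) [] [] [] [] []) := by
  rw [initList_eq, haltList_eq] at h
  exact reachesIn_lift (M := M₁.m) (M' := program toLeft toRight comb bad)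
    (lab := .inl) (ret := .inr (.inr .split)) (Γ' := Alphabet M₁ M₂ ρ γ) (ι := Sum.inl)
    (σ' := State M₁ M₂ ρ γ) (get := fun s => s.fst)
    (set := fun v s => { s with fst := v })
    (G := fun v => clean v M₂.initialState true)
    (F := fun S => contents S (fun _ => []) [] [] [] [] []) (fun _ => rfl) (fun _ => rfl)
    (fun _ _ => rfl) (fun _ _ => rfl) (fun _ _ _ => update_fst ..) h

theorem reachesIn_snd {n : ℕ} {w : List (M₂.Γ M₂.k₀)} {u : List (M₂.Γ M₂.k₁)} (r : List ρ)
    (h : ReachesIn M₂.step n (initList M₂ w) (haltList M₂ u)) :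
    ReachesIn (step (program (M₁ := M₁) toLeft toRight comb bad)) n
      ⟨some (.inr (.inl M₂.main)), clean M₁.initialState M₂.initialState true,
        contents (fun _ => []) (update (fun _ => []) M₂.k₀ w) [] [] r [] []⟩
      (cfg .merge true (fun _ => []) (update (fun _ => []) M₂.k₁ u) [] [] r [] []) := by
  rw [initList_eq, haltList_eq] at h
  exact reachesIn_lift (M := M₂.m) (M' := program toLeft toRight comb bad)
    (lab := fun l => .inr (.inl l)) (ret := .inr (.inr .merge))
    (Γ' := Alphabet M₁ M₂ ρ γ) (ι := fun k => Sum.inr (Sum.inl k))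
    (σ' := State M₁ M₂ ρ γ) (get := fun s => s.snd)
    (set := fun v s => { s with snd := v })
    (G := fun v => clean M₁.initialState v true)
    (F := fun S => contents (fun _ => []) S [] [] r [] []) (fun _ => rfl) (fun _ => rfl)
    (fun _ _ => rfl) (fun _ _ => rfl) (fun _ _ _ => update_snd ..) h

/-- The word that the spliced machine puts out at the end. -/
def output {α β γ : Type} (comb : Option α → Option β → Option γ) (bad : γ) (g : List α)
    (r : List β) : List γ :=
  if (List.zipWithAll comb g r).all Option.isSome then (List.zipWithAll comb g r).reduceOption
  else [bad]

theorem initList_machine [Finite (M₁.Γ M₁.k₁)] [Finite (M₂.Γ M₂.k₁)] [Finite ρ] [Finite γ]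
    (w : List (M₁.Γ M₁.k₀)) :
    initList (machine M₁ M₂ toLeft toRight comb bad) w =
      (⟨some (.inl M₁.main), clean M₁.initialState M₂.initialState true,
        contents (update (fun _ => []) M₁.k₀ w) (fun _ => []) [] [] [] [] []⟩ :
        Cfg (Alphabet M₁ M₂ ρ γ) (Label M₁ M₂) (State M₁ M₂ ρ γ)) := by
  refine (initList_eq (machine M₁ M₂ toLeft toRight comb bad) w).trans ?_
  rw [← update_fst, contents_nil]
  rfl

theorem haltList_machine [Finite (M₁.Γ M₁.k₁)] [Finite (M₂.Γ M₂.k₁)] [Finite ρ] [Finite γ]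
    (w : List γ) :
    haltList (machine M₁ M₂ toLeft toRight comb bad) w =
      (⟨none, clean M₁.initialState M₂.initialState true,
        contents (fun _ => []) (fun _ => []) [] [] [] [] w⟩ :
        Cfg (Alphabet M₁ M₂ ρ γ) (Label M₁ M₂) (State M₁ M₂ ρ γ)) := by
  refine (haltList_eq (machine M₁ M₂ toLeft toRight comb bad) w).trans ?_
  rw [← update_out _ _ _ _ _ _ [], contents_nil]
  rfl

theorem reachesIn_machine [Finite (M₁.Γ M₁.k₁)] [Finite (M₂.Γ M₂.k₁)] [Finite ρ] [Finite γ]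
    {n₁ n₂ : ℕ} {w : List (M₁.Γ M₁.k₀)} {u : List (M₁.Γ M₁.k₁)} {g : List (M₂.Γ M₂.k₁)}
    {x : List γ} (h₁ : ReachesIn M₁.step n₁ (initList M₁ w) (haltList M₁ u))
    (h₂ : ReachesIn M₂.step n₂ (initList M₂ (u.filterMap toLeft)) (haltList M₂ g))
    (hx : output comb bad g (u.filterMap toRight) = x) :
    ReachesIn (machine M₁ M₂ toLeft toRight comb bad).step
      (n₁ + n₂ + 5 * u.length + 2 * g.length + 5)
      (initList (machine M₁ M₂ toLeft toRight comb bad) w)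
      (haltList (machine M₁ M₂ toLeft toRight comb bad) x) := by
  subst hx
  have hl := List.length_filterMap_le toLeft u
  have hr := List.length_filterMap_le toRight u
  have e₁ := reachesIn_fst (M₂ := M₂) toLeft toRight comb bad h₁
  have e₂ := reachesIn_split (M₁ := M₁) (M₂ := M₂) toLeft toRight comb bad u [] []
  have e₃ := reachesIn_loadLeft (M₁ := M₁) (M₂ := M₂) toLeft toRight comb bad
    (u.filterMap toLeft).reverse [] (u.filterMap toRight).reverse
  have e₄ := reachesIn_loadRight (M₁ := M₁) (M₂ := M₂) toLeft toRight comb bad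
    (update (fun _ => []) M₂.k₀ (u.filterMap toLeft)) (u.filterMap toRight).reverse []
  have e₅ := reachesIn_snd (M₁ := M₁) toLeft toRight comb bad (u.filterMap toRight) h₂
  have e₆ := reachesIn_merge (M₁ := M₁) (M₂ := M₂) toLeft toRight comb bad true g
    (u.filterMap toRight) []
  have e₇ := reachesIn_finish (M₁ := M₁) (M₂ := M₂) toLeft toRight comb bad
    ((List.zipWithAll comb g (u.filterMap toRight)).all Option.isSome)
    (List.zipWithAll comb g (u.filterMap toRight)).reduceOption.reverse []
  simp only [List.append_nil, List.reverse_reverse, List.length_reverse, Bool.true_and,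
    Function.update_eq_self] at e₁ e₂ e₃ e₄ e₅ e₆ e₇
  have hz : (List.zipWithAll comb g (u.filterMap toRight)).reduceOption.length ≤
      g.length + (u.filterMap toRight).length :=
    (List.reduceOption_length_le _).trans (length_zipWithAll_le ..)
  -- Splitting and the two loading phases take at most `u.length + 1` steps each, merging and
  -- finishing at most `g.length + u.length + 1` each.
  have h := ((((((e₁.trans e₂).trans e₃).trans e₄).trans e₅).trans e₆).trans e₇).mono
    (n := n₁ + n₂ + 5 * u.length + 2 * g.length + 5) (by omega)
  exact (congrArg₂ (ReachesIn _ _) (initList_machine ..) (haltList_machine ..)).mpr h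

end Splice

/-! ### Polynomial-time functions on words -/

theorem monotone_eval_nat (p : Polynomial ℕ) : Monotone fun n => p.eval n := by
  intro m n h
  simp only [Polynomial.eval_eq_sum_range]
  gcongr

/-- A machine whose runs are bounded by a polynomial computes in polynomial time. -/
theorem computableInPolyTime_of_reachesIn {α β : Type} {F : List α → List β} (tm : FinTM2)
    (i : tm.Γ tm.k₀ ≃ α) (o : tm.Γ tm.k₁ ≃ β) (p : Polynomial ℕ)
    (h : ∀ w, ReachesIn tm.step (p.eval w.length) (initList tm (w.map i.symm))
      (haltList tm ((F w).map o.symm))) :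
    Nonempty (TM2ComputableInPolyTime (id : List α → List α) (id : List β → List β) F) :=
  ⟨⟨⟨tm, i, o⟩, p, fun w => Classical.choice (h w)⟩⟩

/-- A function on words over finite alphabets is computable in polynomial time and has outputs of
polynomial length. -/
def PolyTimeOnWords {α β : Type} (F : List α → List β) : Prop :=
  Nonempty (TM2ComputableInPolyTime (id : List α → List α) (id : List β → List β) F) ∧
    ∃ q : Polynomial ℕ, ∀ w, (F w).length ≤ q.eval w.length

theorem PolyTimeOnWords.identity {α : Type} [Finite α] : PolyTimeOnWords (id : List α → List α) := by
  have := Fintype.ofFinite α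
  exact ⟨⟨idComputableInPolyTime _⟩, .X, by simp⟩

/-- A machine that erases its input and writes a fixed word. -/
def constMachine (α : Type) {β : Type} [Fintype α] (c : List β) : FinTM2 where
  K := Bool
  k₀ := false
  k₁ := true
  Γ k := bif k then β else α
  Λ := Unit
  main := ()
  σ := Bool
  initialState := false
  Γk₀Fin := inferInstanceAs (Fintype α)
  m _ := .pop false (fun _ o => o.isSome) <|
    .branch id (.load (fun _ => false) <| .goto fun _ => ())
      (.pushList true (show List (bif true then β else α) from c) .halt)

theorem PolyTimeOnWords.const {α β : Type} [Finite α] (c : List β) :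
    PolyTimeOnWords (fun _ : List α => c) := by
  have := Fintype.ofFinite α
  refine ⟨computableInPolyTime_of_reachesIn (constMachine α c) (.refl α) (.refl β) (.X + 1)
    fun w => ?_, .C c.length, by simp⟩
  have hw : w.map (Equiv.refl α).symm = w := List.map_id w
  have hc : c.map (Equiv.refl β).symm = c := List.map_id c
  have hinit : initList (constMachine α c) (w.map (Equiv.refl α).symm) = (⟨some (), false,
      update (fun _ => []) false w⟩ : Cfg (constMachine α c).Γ Unit Bool) :=
    (congrArg (initList (constMachine α c)) hw).trans (initList_eq _ _)
  have hhalt : haltList (constMachine α c) (c.map (Equiv.refl β).symm) = (⟨none, false,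
      update (fun _ => []) true c⟩ : Cfg (constMachine α c).Γ Unit Bool) :=
    (congrArg (haltList (constMachine α c)) hc).trans (haltList_eq _ _)
  -- Each erased letter costs one step. Writing `c` costs one more, since a statement is a single
  -- step however many pushes it contains.
  refine .mono (m := w.length + 1) ?_ (by simp)
  refine (congrArg₂ (ReachesIn _ _) hinit hhalt).mpr ?_
  clear hw hinit hhalt
  induction w with
  | nil =>
    refine .single (congrArg some ((stepAux_pushList (Γ := (constMachine α c).Γ) (Λ := Unit) true c
      .halt false (update (update (fun _ => []) false []) false [])).trans ?_))
    refine congrArg (Cfg.mk none false) (funext fun k => ?_)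
    cases k
    · rfl
    · exact List.append_nil c
  | cons a w ih =>
    refine .head (congrArg (fun S => some (Cfg.mk (some ()) false S)) (funext fun k => ?_)) ih
    cases k <;> rfl

variable {α β δ ρ ε γ : Type}

/-- The second machine is timed in the length of the intermediate word; the length bound on `F`
makes this polynomial in the original input. The length bound on `G` pays for merging. -/
theorem PolyTimeOnWords.splice [Finite β] [Finite ρ] [Finite ε] [Finite γ]
    {F : List α → List β} {G : List δ → List ε} (hF : PolyTimeOnWords F) (hG : PolyTimeOnWords G)
    (toLeft : β → Option δ) (toRight : β → Option ρ) (comb : Option ε → Option ρ → Option γ)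
    (bad : γ) :
    Nonempty (TM2ComputableInPolyTime (id : List α → List α) (id : List γ → List γ)
      fun w => Splice.output comb bad (G ((F w).filterMap toLeft)) ((F w).filterMap toRight)) := by
  obtain ⟨⟨⟨⟨M₁, i₁, o₁⟩, t₁, h₁⟩⟩, q₁, hq₁⟩ := hF
  obtain ⟨⟨⟨⟨M₂, i₂, o₂⟩, t₂, h₂⟩⟩, q₂, hq₂⟩ := hG
  have : Finite (M₁.Γ M₁.k₁) := .of_equiv _ o₁.symm
  have : Finite (M₂.Γ M₂.k₁) := .of_equiv _ o₂.symm
  refine computableInPolyTime_of_reachesIn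
    (Splice.machine M₁ M₂ (fun b => (toLeft (o₁ b)).map i₂.symm) (fun b => toRight (o₁ b))
      (fun e => comb (e.map o₂)) bad) i₁ (.refl γ)
    (t₁ + t₂.comp q₁ + 5 * q₁ + 2 * q₂.comp q₁ + 5) fun w => ?_
  simp only [id_eq, Equiv.invFun_as_coe] at h₁ h₂
  have e₁ : ReachesIn _ _ _ _ := ⟨h₁ w⟩
  have e₂ : ReachesIn _ _ _ _ := ⟨h₂ ((F w).filterMap toLeft)⟩
  have hz : ∀ (g : List ε) (r : List ρ),
      List.zipWithAll (fun e => comb (Option.map o₂ e)) (g.map o₂.symm) r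
        = List.zipWithAll comb g r := by
    intro g
    induction g with
    | nil => simp
    | cons a g ih =>
      rintro (_ | ⟨b, r⟩)
      · simp
      · simp [ih]
  have hl : (((F w).map o₁.symm).filterMap fun b => (toLeft (o₁ b)).map i₂.symm)
      = ((F w).filterMap toLeft).map i₂.symm := by
    simp [List.filterMap_map, List.map_filterMap]
  have hr : (((F w).map o₁.symm).filterMap fun b => toRight (o₁ b)) = (F w).filterMap toRight := by
    simp [List.filterMap_map]
  rw [← hl] at e₂
  have hx : Splice.output (fun e => comb (Option.map o₂ e)) bad
      ((G ((F w).filterMap toLeft)).map o₂.symm)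
      (((F w).map o₁.symm).filterMap fun b => toRight (o₁ b))
      = (Splice.output comb bad (G ((F w).filterMap toLeft)) ((F w).filterMap toRight)).map
        (Equiv.refl γ).symm := by
    rw [hr, Splice.output, hz]
    exact (List.map_id _).symm
  refine (Splice.reachesIn_machine _ _ _ bad e₁ e₂ hx).mono ?_
  have hu : ((F w).filterMap toLeft).length ≤ q₁.eval w.length :=
    (List.length_filterMap_le _ _).trans (hq₁ w)
  have ht₂ := monotone_eval_nat t₂ hu
  have hg := (hq₂ ((F w).filterMap toLeft)).trans (monotone_eval_nat q₂ hu)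
  have hFw := hq₁ w
  simp only [List.length_map, Polynomial.eval_add, Polynomial.eval_comp,
    Polynomial.eval_mul, Polynomial.eval_ofNat]
  dsimp only at ht₂ hg
  linarith

end Turing

/-! ### Idempotents of inverse monoids -/

section InverseMonoid

variable {S : Type} [Monoid S]

theorem IsMutualInverse.symm {a b : S} (h : IsMutualInverse a b) : IsMutualInverse b a :=
  ⟨h.2, h.1⟩

theorem isMutualInverse_self_of_idempotent {e : S} (he : e * e = e) : IsMutualInverse e e := by
  simp [IsMutualInverse, he]

/-- If `x` is the inverse of `e * f`, so is `f * x * e`; hence they agree, which makes `x`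
idempotent. Then `x` and `e * f` are both inverses of `x`, hence equal. -/
theorem IsInverseMonoid.mul_idempotent (hS : IsInverseMonoid S) {e f : S} (he : e * e = e)
    (hf : f * f = f) : e * f * (e * f) = e * f := by
  obtain ⟨x, hx, hux⟩ := hS (e * f)
  have hx₁ : e * f * x * (e * f) = e * f := hx.1
  have hx₂ : x * (e * f) * x = x := hx.2
  have hfxe : f * x * e = x := by
    refine hux _ ⟨?_, ?_⟩
    · calc e * f * (f * x * e) * (e * f) = e * (f * f) * x * (e * e) * f := by
            simp only [mul_assoc]
        _ = e * f := by rw [he, hf]; simpa only [mul_assoc] using hx₁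
    · calc f * x * e * (e * f) * (f * x * e) = f * (x * ((e * e) * (f * f)) * x) * e := by
            simp only [mul_assoc]
        _ = f * x * e := by rw [he, hf, hx₂]
  have hxx : x * x = x := by
    calc x * x = (f * x * e) * (f * x * e) := by rw [hfxe]
      _ = f * (x * (e * f) * x) * e := by simp only [mul_assoc]
      _ = x := by rw [hx₂, hfxe]
  obtain ⟨y, -, huy⟩ := hS x
  have : e * f = x :=
    (huy _ (IsMutualInverse.symm hx)).trans (huy _ (isMutualInverse_self_of_idempotent hxx)).symm
  rw [this, hxx]

/-- Idempotents of an inverse monoid commute. -/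
theorem IsInverseMonoid.idempotent_comm (hS : IsInverseMonoid S) {e f : S} (he : e * e = e)
    (hf : f * f = f) : e * f = f * e := by
  have hef := hS.mul_idempotent he hf
  have hfe := hS.mul_idempotent hf he
  obtain ⟨y, -, huy⟩ := hS (e * f)
  -- Being idempotent, `e * f` is its own inverse; `f * e` is another one.
  refine (huy _ (isMutualInverse_self_of_idempotent hef)).trans (huy _ ⟨?_, ?_⟩).symm
  · calc e * f * (f * e) * (e * f) = e * (f * f) * (e * e) * f := by simp only [mul_assoc]
      _ = e * f := by rw [he, hf]; simpa only [mul_assoc] using hef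
  · calc f * e * (e * f) * (f * e) = f * (e * e) * (f * f) * e := by simp only [mul_assoc]
      _ = f * e := by rw [he, hf]; simpa only [mul_assoc] using hfe

end InverseMonoid

/-! ### Closure properties of `fP` -/

section PolyTime

variable {A : Type}

theorem PFun.mem_mul {α : Type} {f g : α →. α} {x y : α} :
    y ∈ (f * g) x ↔ ∃ z ∈ g x, y ∈ f z := by
  exact Part.mem_bind_iff

theorem PFun.mem_one {α : Type} {x y : α} : y ∈ (1 : α →. α) x ↔ y = x := by
  change y ∈ PFun.id α x ↔ _
  simp

open Classical in
/-- The word that encodes the outcome of `f`. -/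
noncomputable def outcome (f : List A →. List A) (w : List A) : List (Option A) :=
  encodeOutcome (f w).toOption

theorem outcome_of_mem {f : List A →. List A} {w y : List A} (h : y ∈ f w) :
    outcome f w = y.map some := by
  classical
  rw [outcome, Part.toOption_eq_some_iff.2 h]
  rfl

theorem outcome_of_not_dom {f : List A →. List A} {w : List A} (h : ¬(f w).Dom) :
    outcome f w = [none] := by
  classical
  rw [outcome, Part.toOption_eq_none_iff.2 h]
  rfl

theorem outcome_eq_map_some_iff {f : List A →. List A} {w y : List A} :
    outcome f w = y.map some ↔ y ∈ f w := by
  refine ⟨fun h => ?_, outcome_of_mem⟩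
  by_cases hd : (f w).Dom
  · have hm := Part.get_mem hd
    rw [outcome_of_mem hm] at h
    rwa [List.map_injective_iff.2 (Option.some_injective A) h] at hm
  · rw [outcome_of_not_dom hd] at h
    cases y <;> simp at h

/-- Outputs are compared after encoding, so the encoding may be moved into the function without
changing the machine. -/
theorem polyTimeComputable_iff {f : List A →. List A} :
    PolyTimeComputable f ↔ Nonempty (TM2ComputableInPolyTime (id : List A → List A)
      (id : List (Option A) → List (Option A)) (outcome f)) :=
  ⟨fun ⟨h⟩ => ⟨⟨h.toTM2ComputableAux, h.time, h.outputsFun⟩⟩,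
    fun ⟨h⟩ => ⟨⟨h.toTM2ComputableAux, h.time, h.outputsFun⟩⟩⟩

theorem polyTimeOnWords_outcome {f : List A →. List A} (hf : f ∈ fP A) :
    PolyTimeOnWords (outcome f) := by
  obtain ⟨p, hp⟩ := hf.1
  -- The extra `1` leaves room for the rejection symbol.
  refine ⟨polyTimeComputable_iff.1 hf.2, p + 1, fun w => ?_⟩
  by_cases hd : (f w).Dom
  · have hm := Part.get_mem hd
    have := (hp _ _ hm).1
    rw [outcome_of_mem hm]
    simp only [List.length_map, Polynomial.eval_add, Polynomial.eval_one]
    omega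
  · rw [outcome_of_not_dom hd]
    simp

theorem mul_mem_fP [Finite A] {f g : List A →. List A} (hf : f ∈ fP A) (hg : g ∈ fP A) :
    f * g ∈ fP A := by
  refine ⟨?_, ?_⟩
  · obtain ⟨p, hp⟩ := hf.1
    obtain ⟨q, hq⟩ := hg.1
    refine ⟨p.comp q + q.comp p, fun x z hz => ?_⟩
    obtain ⟨y, hy, hz⟩ := PFun.mem_mul.1 hz
    have h₁ := hp _ _ hz
    have h₂ := hq _ _ hy
    have h₃ := h₁.1.trans (monotone_eval_nat p h₂.1)
    have h₄ := h₂.2.trans (monotone_eval_nat q h₁.2)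
    simp only [Polynomial.eval_add, Polynomial.eval_comp]
    dsimp only at h₃ h₄
    omega
  · rw [polyTimeComputable_iff]
    -- If `g` rejects, its symbol `none` goes to the right word, where it makes the merge fail.
    -- Otherwise that word is empty and the outcome of `f` passes unchanged.
    convert (polyTimeOnWords_outcome hg).splice (polyTimeOnWords_outcome hf) (ρ := Unit)
      (fun a => a) (fun a => if a.isSome then none else some ())
      (fun e r => if r.isSome then none else e) none using 2
    funext w
    by_cases hd : (g w).Dom
    · have hm := Part.get_mem hd
      have hr : outcome (f * g) w = outcome f ((g w).get hd) := by
        classical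
        have : (f * g) w = f ((g w).get hd) := by
          ext z
          rw [PFun.mem_mul]
          exact ⟨fun ⟨y, hy, hz⟩ => Part.mem_unique hm hy ▸ hz, fun hz => ⟨_, hm, hz⟩⟩
        simp only [outcome, this]
      rw [hr, outcome_of_mem hm]
      simp [Splice.output, List.reduceOption, List.filterMap_map, Function.comp_def]
    · have hd' : ¬((f * g) w).Dom := by
        rw [Part.dom_iff_mem] at hd ⊢
        rintro ⟨z, hz⟩
        obtain ⟨y, hy, -⟩ := PFun.mem_mul.1 hz
        exact hd ⟨y, hy⟩
      rw [outcome_of_not_dom hd, outcome_of_not_dom hd']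
      simp only [Splice.output]
      cases outcome f (List.filterMap (fun a => a) [none]) <;> simp

/-- The identity, restricted to the fixed points of `e`. -/
def fixedPointsId (e : List A →. List A) : List A →. List A :=
  fun w => ⟨w ∈ e w, fun _ => w⟩

theorem mem_fixedPointsId {e : List A →. List A} {x y : List A} :
    y ∈ fixedPointsId e x ↔ y = x ∧ x ∈ e x :=
  ⟨fun ⟨h, hy⟩ => ⟨hy.symm, h⟩, fun ⟨hy, h⟩ => ⟨h, hy.symm⟩⟩

open Classical in
/-- The letter on which two words agree, at a position where they do. -/
noncomputable def agree : Option (Option A) → Option A → Option (Option A)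
  | some (some a), some b => if a = b then some (some a) else none
  | _, _ => none

/-- `List.zipWithAll` pads the shorter word with `none`, where `agree` is undefined, so different
lengths are detected as well. -/
theorem output_agree (x : List (Option A)) (w : List A) [Decidable (x = w.map some)] :
    Splice.output agree none x w = if x = w.map some then w.map some else [none] := by
  split_ifs with h
  · subst h
    have : List.zipWithAll agree (w.map some) w = w.map (fun a => some (some a)) := by
      induction w with
      | nil => rfl
      | cons a w ih => simp [agree, ih]
    simp [Splice.output, this, List.reduceOption, List.filterMap_map, Function.comp_def]
  · have : (List.zipWithAll agree x w).all Option.isSome = false := by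
      classical
      induction x generalizing w with
      | nil => cases w <;> simp_all [agree]
      | cons a x ih =>
        cases w with
        | nil => cases a <;> simp [agree]
        | cons b w =>
          cases a with
          | none => simp [agree]
          | some a =>
            by_cases hab : a = b
            · subst hab
              simp only [List.zipWithAll_cons_cons, List.all_cons]
              rw [ih w, Bool.and_false]
              simpa using h
            · simp [agree, hab]
    simp [Splice.output, this]

/-- The input is kept as the right word while `e` runs on a copy, and the two are then compared.
Balance of `e` is not required, so that constant maps are covered. -/
theorem fixedPointsId_mem_fP [Finite A] {e : List A →. List A}
    (he : PolyTimeOnWords (outcome e)) : fixedPointsId e ∈ fP A := by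
  refine ⟨⟨.X, fun x y h => ?_⟩, ?_⟩
  · obtain ⟨rfl, -⟩ := mem_fixedPointsId.1 h
    simp
  · classical
    rw [polyTimeComputable_iff]
    convert (PolyTimeOnWords.identity (α := A)).splice he some some agree none using 2
    funext w
    simp only [id_eq, List.filterMap_some]
    rw [output_agree]
    split_ifs with h
    · exact outcome_of_mem (mem_fixedPointsId.2 ⟨rfl, outcome_eq_map_some_iff.1 h⟩)
    · exact outcome_of_not_dom fun hd => h (outcome_of_mem hd)

theorem one_mem_fP [Finite A] : (1 : List A →. List A) ∈ fP A := by
  have h₀ : (fun w => w.map some : List A → List (Option A)) = outcome 1 := by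
    funext w
    exact (outcome_of_mem (PFun.mem_one.2 rfl)).symm
  refine ⟨⟨.X, fun x y h => ?_⟩, ?_⟩
  · rw [PFun.mem_one.1 h]
    simp
  · rw [polyTimeComputable_iff, ← h₀]
    -- The merge only recodes letters of `A` as letters of `Option A`.
    convert (PolyTimeOnWords.identity (α := A)).splice (PolyTimeOnWords.identity (α := A))
      (ρ := Unit) some (fun _ => none) (fun e _ => e.map some) none using 2
    funext w
    simp [Splice.output, List.reduceOption, List.filterMap_map, Function.comp_def]

end PolyTime

/-! ### Inverses in `invfP` and maximality -/

section Inverse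

variable {A : Type}

/-- A given `f'` may also be defined outside the image of `f`. The image is decidable in polynomial
time as the set of fixed points of `f * f'`, and on it `f'` inverts `f` by injectivity. -/
theorem mem_invfP_iff [Finite A] {f : List A →. List A} :
    f ∈ invfP A ↔ f ∈ fP A ∧ ∃ g ∈ fP A, ∀ x y, x ∈ g y ↔ y ∈ f x := by
  constructor
  · rintro ⟨hf, hinj, f', hf', h⟩
    refine ⟨hf, f' * fixedPointsId (f * f'), mul_mem_fP hf' (fixedPointsId_mem_fP
      (polyTimeOnWords_outcome (mul_mem_fP hf hf'))), fun x y => ?_⟩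
    simp only [PFun.mem_mul, mem_fixedPointsId]
    constructor
    · rintro ⟨_, ⟨rfl, z, hz, hy⟩, hx⟩
      rwa [Part.mem_unique hx hz]
    · intro hy
      have hy' := hy
      rw [← h] at hy'
      obtain ⟨y', hy', hy''⟩ := PFun.mem_mul.1 hy'
      obtain rfl := Part.mem_unique hy hy'
      obtain ⟨z, hz, hyz⟩ := PFun.mem_mul.1 hy''
      obtain rfl := hinj _ _ _ hy hyz
      exact ⟨y, ⟨rfl, x, hz, hyz⟩, hz⟩
  · rintro ⟨hf, g, hg, h⟩
    refine ⟨hf, fun x₁ x₂ y h₁ h₂ => Part.mem_unique ((h _ _).2 h₁) ((h _ _).2 h₂), g, hg, ?_⟩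
    refine PFun.ext fun x y => ?_
    simp only [PFun.mem_mul, h]
    constructor
    · rintro ⟨y', hy', z, hz, hy⟩
      rwa [Part.mem_unique ((h _ _).2 hy') ((h _ _).2 hz)]
    · exact fun hy => ⟨y, hy, x, hy, hy⟩

/-- The monoid of polynomially balanced polynomial-time computable partial functions. -/
def fPSubmonoid (A : Type) [Finite A] : Submonoid (List A →. List A) where
  carrier := fP A
  mul_mem' := mul_mem_fP
  one_mem' := one_mem_fP

/-- The monoid of injective regular elements of `fP A`. -/
def invfPSubmonoid (A : Type) [Finite A] : Submonoid (List A →. List A) where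
  carrier := invfP A
  mul_mem' := by
    intro f g hf hg
    obtain ⟨hf, f', hf', hff'⟩ := mem_invfP_iff.1 hf
    obtain ⟨hg, g', hg', hgg'⟩ := mem_invfP_iff.1 hg
    refine mem_invfP_iff.2 ⟨mul_mem_fP hf hg, g' * f', mul_mem_fP hg' hf', fun x y => ?_⟩
    simp only [PFun.mem_mul, hff', hgg', and_comm]
  one_mem' := mem_invfP_iff.2 ⟨one_mem_fP, 1, one_mem_fP, fun x y => by
    simp only [PFun.mem_one, eq_comm]⟩

theorem mem_iff_of_isMutualInverse {a b : List A →. List A} (h : IsMutualInverse a b)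
    (ha : PartialInjective a) (hb : PartialInjective b) {x y : List A} : x ∈ b y ↔ y ∈ a x := by
  constructor
  · intro hx
    obtain ⟨x₁, hx₁, hx₂⟩ := PFun.mem_mul.1 (h.2.symm ▸ hx : x ∈ (b * a * b) y)
    obtain rfl := Part.mem_unique hx hx₁
    obtain ⟨y₁, hy₁, hy₂⟩ := PFun.mem_mul.1 hx₂
    rwa [hb _ _ _ hx hy₂]
  · intro hy
    obtain ⟨y₁, hy₁, hy₂⟩ := PFun.mem_mul.1 (h.1.symm ▸ hy : y ∈ (a * b * a) x)
    obtain rfl := Part.mem_unique hy hy₁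
    obtain ⟨x₁, hx₁, hx₂⟩ := PFun.mem_mul.1 hy₂
    rwa [ha _ _ _ hy hx₂]

theorem isInverseMonoid_invfPSubmonoid [Finite A] : IsInverseMonoid (invfPSubmonoid A) := by
  rintro ⟨a, ha⟩
  obtain ⟨haf, b, hb, hab⟩ := mem_invfP_iff.1 ha
  have hbI : b ∈ invfPSubmonoid A :=
    mem_invfP_iff.2 ⟨hb, a, haf, fun x y => (hab y x).symm⟩
  refine ⟨⟨b, hbI⟩, ⟨Subtype.ext (PFun.ext fun x y => ?_), Subtype.ext (PFun.ext fun y x => ?_)⟩,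
    ?_⟩
  · change y ∈ (a * b * a) x ↔ y ∈ a x
    simp only [PFun.mem_mul, hab]
    constructor
    · rintro ⟨y', hy', z, hz, hy⟩
      rwa [ha.2.1 _ _ _ hy' hz]
    · exact fun hy => ⟨y, hy, x, hy, hy⟩
  · change x ∈ (b * a * b) y ↔ x ∈ b y
    simp only [PFun.mem_mul, hab]
    constructor
    · rintro ⟨x', hx', z, hz, hx⟩
      rwa [Part.mem_unique hx' hz]
    · exact fun hx => ⟨x, hx, y, hx, hx⟩
  · rintro ⟨c, hc⟩ h
    have hac : IsMutualInverse a c :=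
      ⟨congrArg Subtype.val h.1, congrArg Subtype.val h.2⟩
    exact Subtype.ext (PFun.ext fun y x =>
      (mem_iff_of_isMutualInverse hac ha.2.1 hc.2.1).trans (hab x y).symm)

/-- The identity on a single word. -/
def singletonId (w : List A) : List A →. List A :=
  fixedPointsId (PFun.pure w)

theorem mem_singletonId {w x y : List A} : y ∈ singletonId w x ↔ y = x ∧ x = w := by
  rw [singletonId, mem_fixedPointsId]
  exact and_congr_right fun _ => Part.mem_some_iff

theorem singletonId_mem_invfP [Finite A] (w : List A) : singletonId w ∈ invfP A := by
  have h : singletonId w ∈ fP A := by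
    refine fixedPointsId_mem_fP ?_
    have : outcome (PFun.pure w) = fun _ : List A => w.map some :=
      funext fun x => outcome_of_mem (Part.mem_some w)
    rw [this]
    exact .const _
  -- A partial identity is its own inverse relation.
  refine mem_invfP_iff.2 ⟨h, _, h, fun x y => ?_⟩
  simp only [mem_singletonId]
  grind

theorem singletonId_mul_self (w : List A) : singletonId w * singletonId w = singletonId w := by
  refine PFun.ext fun x y => ?_
  simp only [PFun.mem_mul, mem_singletonId]
  grind

/-- In an inverse monoid of partial functions that contains the identities on single words, the
elements are injective: these identities commute with the idempotent `b * a`. -/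
theorem partialInjective_of_isInverseMonoid {M : Submonoid (List A →. List A)}
    (hM : IsInverseMonoid M) (hsing : ∀ w, singletonId w ∈ M) {a b : List A →. List A}
    (ha : a ∈ M) (hb : b ∈ M) (hab : a * b * a = a) : PartialInjective a := by
  have key : ∀ x y z, y ∈ a x → z ∈ b y → z = x := by
    intro x y z hy hz
    have hidem : (⟨b * a, M.mul_mem hb ha⟩ : M) * ⟨b * a, M.mul_mem hb ha⟩
        = ⟨b * a, M.mul_mem hb ha⟩ :=
      Subtype.ext (by
        change b * a * (b * a) = b * a
        rw [mul_assoc, ← mul_assoc a, hab])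
    have hsidem : (⟨singletonId x, hsing x⟩ : M) * ⟨singletonId x, hsing x⟩
        = ⟨singletonId x, hsing x⟩ := Subtype.ext (singletonId_mul_self x)
    have hcomm : singletonId x * (b * a) = b * a * singletonId x :=
      congrArg Subtype.val (hM.idempotent_comm hsidem hidem)
    -- At `x` this product has the value `z`, while the product in the other order can only have the
    -- value `x`.
    have hzx : z ∈ (b * a * singletonId x) x :=
      PFun.mem_mul.2 ⟨x, mem_singletonId.2 ⟨rfl, rfl⟩, PFun.mem_mul.2 ⟨y, hy, hz⟩⟩
    rw [← hcomm] at hzx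
    obtain ⟨z', -, hz'⟩ := PFun.mem_mul.1 hzx
    obtain ⟨rfl, rfl⟩ := mem_singletonId.1 hz'
    rfl
  intro x₁ x₂ y h₁ h₂
  -- By `a * b * a = a`, `b` is defined at `y`; its value there is both `x₁` and `x₂`.
  obtain ⟨y', hy', hy⟩ := PFun.mem_mul.1 (hab.symm ▸ h₁ : y ∈ (a * b * a) x₁)
  obtain rfl := Part.mem_unique h₁ hy'
  obtain ⟨z, hz, -⟩ := PFun.mem_mul.1 hy
  rw [← key _ _ _ h₁ hz, ← key _ _ _ h₂ hz]

end Inverse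

theorem proposition2p4 (A : Type) [Finite A] :
    ∃ F I : Submonoid (List A →. List A),
      (F : Set (List A →. List A)) = fP A ∧
      (I : Set (List A →. List A)) = invfP A ∧
      IsInverseSubmonoid F I ∧
      ∀ M : Submonoid (List A →. List A), IsInverseSubmonoid F M → I ≤ M → M = I := by
  refine ⟨fPSubmonoid A, invfPSubmonoid A, rfl, rfl, ⟨fun f hf => hf.1,
    isInverseMonoid_invfPSubmonoid⟩, fun M hM hIM => le_antisymm (fun a ha => ?_) hIM⟩
  obtain ⟨⟨b, hb⟩, hab, -⟩ := hM.2 ⟨a, ha⟩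
  have hab : a * b * a = a := congrArg Subtype.val hab.1
  exact ⟨hM.1 ha, partialInjective_of_isInverseMonoid hM.2
    (fun w => hIM (singletonId_mem_invfP w)) ha hb hab, b, hM.1 hb, hab⟩
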